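/- Let $n\ge 0$ and $d\ge 1$ be integers and $e=(1,0,\dots,0)\in\mathbb{R}^{n+1}$. Let $F\in\mathbb{R}[t,x_1,\dots,x_n]$ be homogeneous of degree $d$ with $F(e)=1$. For a real parameter $s$ consider the following linear operators on polynomials $P\in\mathbb{R}[t,x_1,\dots,x_n]$: \[ T^{x_i}_s(P)=P+s\,x_i\,\frac{\partial P}{\partial t}\ (1\le i\le n),\qquad G_s(P)=P(t,sx_1,\dots,sx_n), \] \[ H_s=(T^{x_1}_s)^d\cdots(T^{x_n}_s)^d,\qquad N_s=H_{1-s}\,G_s, \] where products and powers mean composition. Regarding $s$ as a further variable, let $\Delta_N(F)\in\mathbb{R}[s,x_1,\dots,x_n]$ be the discriminant of $N_s(F)$ with respect to the variable $t$ (the N-path discriminant of $F$). If $\Delta_N(F)(s,a)\neq 0$ for all $s\in(0,1)$ and all $a\in\mathbb{R}^n\setminus\{0\}$, then $F$ is hyperbolic with respect to $e$, i.e. $F(e)\ne 0$ and for every $a\in\mathbb{R}^{n+1}$ all complex roots of the univariate polynomial $F(te-a)\in\mathbb{R}[t]$ are real. -/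

import Mathlib

noncomputable section

namespace NPath

/-- A real univariate polynomial is real rooted if all its complex roots are real. -/
def RealRooted (p : Polynomial ℝ) : Prop :=
  ∀ z : ℂ, Polynomial.aeval z p = 0 → z.im = 0

/-- The univariate polynomial `F(te - a) ∈ ℝ[t]`. -/
def restrictLine {m : ℕ} (F : MvPolynomial (Fin m) ℝ) (e a : Fin m → ℝ) : Polynomial ℝ :=
  MvPolynomial.aeval
    (fun i => Polynomial.X * Polynomial.C (e i) - Polynomial.C (a i)) F

/-- A form `F` is hyperbolic with respect to `e` if `F(e) ≠ 0` and `F(te - a) ∈ ℝ[t]` is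
real rooted for every real vector `a`. -/
def IsHyperbolic {m : ℕ} (F : MvPolynomial (Fin m) ℝ) (e : Fin m → ℝ) : Prop :=
  (∃ d : ℕ, F.IsHomogeneous d) ∧ MvPolynomial.eval e F ≠ 0 ∧
    ∀ a : Fin m → ℝ, RealRooted (restrictLine F e a)

/-- The point `e = (1, 0, …, 0) ∈ ℝ^{n+1}`. -/
def basePoint (n : ℕ) : Fin (n + 1) → ℝ := Fin.cons 1 0

/-- The set of forms of degree `d` in `ℝ[t, x₁, …, xₙ]` (variable `0` is `t`, variable `i + 1` is
the `i`-th of the `x`'s, counting from `0`) with `F(e) = 1`. -/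
def formSet (n d : ℕ) : Set (MvPolynomial (Fin (n + 1)) ℝ) :=
  {F | F.IsHomogeneous d ∧ MvPolynomial.eval (basePoint n) F = 1}

section Operators

variable {R : Type*} [CommRing R] {n : ℕ}

/-- The operator `T^ℓ_s : F ↦ F + s ℓ ∂F/∂t` on `R[t, x₁, …, xₙ]`, for `ℓ ∈ R[x₁, …, xₙ]`. -/
def opT (l : MvPolynomial (Fin n) R) (s : R) :
    Module.End R (MvPolynomial (Fin (n + 1)) R) :=
  LinearMap.id +
    s • (LinearMap.mulLeft R (MvPolynomial.rename Fin.succ l) ∘ₗ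
      (MvPolynomial.pderiv (0 : Fin (n + 1))).toLinearMap)

/-- The operator `G_s : F(t, x) ↦ F(t, s x)`. -/
def opG (s : R) : Module.End R (MvPolynomial (Fin (n + 1)) R) :=
  (MvPolynomial.aeval (Fin.cons (MvPolynomial.X 0)
      (fun i : Fin n => MvPolynomial.C s * MvPolynomial.X i.succ) :
      Fin (n + 1) → MvPolynomial (Fin (n + 1)) R)).toLinearMap

/-- The operator `H_s = (T^{x₁}_s)^d ⋯ (T^{xₙ}_s)^d`, the product being composition. -/
def opH (d : ℕ) (s : R) : Module.End R (MvPolynomial (Fin (n + 1)) R) :=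
  (List.ofFn fun i : Fin n => opT (MvPolynomial.X i) s ^ d).prod

/-- The operator `N_s = H_{1-s} G_s`. -/
def opN (d : ℕ) (s : R) : Module.End R (MvPolynomial (Fin (n + 1)) R) :=
  opH d (1 - s) * opG s

/-- The discriminant of `F ∈ R[t, x₁, …, xₙ]` with respect to the variable `t`,
an element of `R[x₁, …, xₙ]`. -/
def discrT (F : MvPolynomial (Fin (n + 1)) R) : MvPolynomial (Fin n) R :=
  (MvPolynomial.finSuccEquiv R n F).discr

end Operators

/-- The N-path discriminant `Δ_N(F) = Δ(N_s(F)) ∈ ℝ[s, x₁, …, xₙ] = ℝ[s][x₁, …, xₙ]`: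
the operator `N_s` is taken over the coefficient ring `ℝ[s]` with parameter the variable `s`. -/
def nPathDiscr {n : ℕ} (d : ℕ) (F : MvPolynomial (Fin (n + 1)) ℝ) :
    MvPolynomial (Fin n) (Polynomial ℝ) :=
  discrT (opN d (Polynomial.X : Polynomial ℝ) (MvPolynomial.map Polynomial.C F))

/-- The value at `(s, a)` of a polynomial in `ℝ[s, x₁, …, xₙ] = ℝ[s][x₁, …, xₙ]`. -/
def evalAt {n : ℕ} (P : MvPolynomial (Fin n) (Polynomial ℝ)) (s : ℝ) (a : Fin n → ℝ) : ℝ :=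
  MvPolynomial.eval₂ (Polynomial.evalRingHom s) a P

end NPath

end

noncomputable section

namespace NPath

/-! Fix a nonzero `b` in ℝⁿ and let `p s = N_s(F)(t, b)`, a continuous path of monic polynomials of
degree `d`. It ends at `p 1 = F(t, b)`. At `s = 0` the form collapses to `t ^ d`, so `p 0` is the
product of the operators `(1 + bᵢ d/dt) ^ d` applied to `t ^ d`. By Hermite–Poulain each factor
preserves real-rootedness; one with `bᵢ ≠ 0` also lowers the multiplicity of multiple roots and
creates only simple new ones. Hence `p 0` has `d` simple real roots (`splitsMult_pathAt_zero`).

For `0 < s < 1` the discriminant hypothesis excludes multiple roots. Being split is a closed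
condition on the path, and open where the roots are simple, so it propagates to `s = 1`
(`splits_of_path`). Every `F(te - a)` is a translate of some `F(t, b)`, with `b = 0` giving `t ^ d`.
-/

open Polynomial Filter Topology

/-! ### Splitting over ℝ as a family of closed inequalities. -/

section RealRootedness

/-- A real polynomial splits over `ℝ` as soon as its modulus at every complex `z` is
at least `|Im z| ^ d`, with `d` its degree. -/
lemma splits_of_im_pow_le {p : ℝ[X]}
    (h : ∀ z : ℂ, |z.im| ^ p.natDegree ≤ ‖aeval z p‖) : p.Splits := by
  refine Splits.of_splits_map Complex.ofRealHom (IsAlgClosed.splits _) fun z hz => ?_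
  have hz0 : aeval z p = 0 := by
    have := (mem_roots'.1 hz).2
    rwa [IsRoot.def, eval_map] at this
  have hz1 := h z
  rw [hz0, norm_zero] at hz1
  have him : z.im = 0 := by
    by_contra hne
    exact absurd hz1 (not_le.2 (pow_pos (abs_pos.2 hne) _))
  exact ⟨z.re, by apply Complex.ext <;> simp [him]⟩

/-- Each real root contributes a factor with `|z - r| ≥ |Im z|`. -/
lemma im_pow_le_of_splits {p : ℝ[X]} (hp : p.Monic) (hs : p.Splits) (z : ℂ) :
    |z.im| ^ p.natDegree ≤ ‖aeval z p‖ := by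
  have h1 : aeval z p = (p.roots.map fun r : ℝ => z - r).prod := by
    conv_lhs => rw [hs.eq_prod_roots_of_monic hp]
    rw [map_multiset_prod, Multiset.map_map]
    simp
  rw [h1, hs.natDegree_eq_card_roots]
  induction p.roots using Multiset.induction_on with
  | empty => simp
  | cons r m ih =>
    rw [Multiset.card_cons, pow_succ', Multiset.map_cons, Multiset.prod_cons, norm_mul]
    refine mul_le_mul ?_ ih (by positivity) (by positivity)
    simpa using Complex.abs_im_le_norm (z - r)

lemma realRooted_of_splits {p : ℝ[X]} (hp : p.Monic) (hs : p.Splits) : RealRooted p := by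
  intro z hz
  by_contra hne
  have := im_pow_le_of_splits hp hs z
  rw [hz, norm_zero] at this
  exact absurd this (not_le.2 (pow_pos (abs_pos.2 hne) _))

end RealRootedness

/-! ### Sign properties of the logarithmic derivative. -/

section LogDerivative

/-- Away from the roots the expression is `p² ∑ 1 / (x - r)²`, that is `-p² (p'/p)'`. It will
exclude new double roots. -/
lemma laguerre_prod (m : Multiset ℝ) (x : ℝ) :
    let p : ℝ[X] := (m.map fun r => X - C r).prod
    0 ≤ p.derivative.eval x ^ 2 - p.eval x * p.derivative.derivative.eval x ∧
      (m ≠ 0 → p.eval x ≠ 0 →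
        0 < p.derivative.eval x ^ 2 - p.eval x * p.derivative.derivative.eval x) := by
  induction m using Multiset.induction_on with
  | empty => simp
  | cons r m ih =>
    intro p
    have hp : p = (X - C r) * (m.map fun r => X - C r).prod := by simp [p]
    set g : ℝ[X] := (m.map fun r => X - C r).prod
    have key : p.derivative.eval x ^ 2 - p.eval x * p.derivative.derivative.eval x =
        g.eval x ^ 2 + (x - r) ^ 2 *
          (g.derivative.eval x ^ 2 - g.eval x * g.derivative.derivative.eval x) := by
      rw [hp]
      simp only [derivative_mul, derivative_sub, derivative_X, derivative_C, derivative_add,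
        eval_mul, eval_sub, eval_add, eval_X, eval_C, sub_zero, one_mul]
      ring
    rw [key]
    have h1 : 0 ≤ (x - r) ^ 2 *
          (g.derivative.eval x ^ 2 - g.eval x * g.derivative.derivative.eval x) :=
      mul_nonneg (sq_nonneg _) ih.1
    refine ⟨by positivity, fun _ h0 => ?_⟩
    have hg : g.eval x ≠ 0 := by
      intro h
      apply h0
      rw [hp, eval_mul, h, mul_zero]
    positivity

/-- In `p'/p = ∑ 1 / (z - r)` every term has imaginary part of sign opposite to `Im z`; multiplying
by `|p|²` avoids the division. -/
lemma im_derivative_mul_conj_prod (m : Multiset ℝ) (z : ℂ) (hz : z.im ≠ 0) :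
    let p : ℝ[X] := (m.map fun r => X - C r).prod
    z.im * (aeval z p.derivative * (starRingEnd ℂ) (aeval z p)).im ≤ 0 ∧
      (m ≠ 0 → z.im * (aeval z p.derivative * (starRingEnd ℂ) (aeval z p)).im < 0) := by
  induction m using Multiset.induction_on with
  | empty => simp
  | cons r m ih =>
    intro p
    have hp : p = (X - C r) * (m.map fun r => X - C r).prod := by simp [p]
    have hg0 : aeval z (m.map fun r => (X - C r : ℝ[X])).prod ≠ 0 := by
      rw [map_multiset_prod, Multiset.map_map, ne_eq, Multiset.prod_eq_zero_iff]
      simp only [Multiset.mem_map, Function.comp_apply, not_exists, not_and]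
      intro w _ h
      apply hz
      have := congrArg Complex.im h
      simpa using this
    set g : ℝ[X] := (m.map fun r => X - C r).prod
    have key : z.im * (aeval z p.derivative * (starRingEnd ℂ) (aeval z p)).im =
        -(z.im ^ 2 * Complex.normSq (aeval z g)) + Complex.normSq (z - r) *
          (z.im * (aeval z g.derivative * (starRingEnd ℂ) (aeval z g)).im) := by
      rw [hp]
      simp only [derivative_mul, derivative_X, derivative_C, map_mul, map_sub, map_add,
        aeval_X, aeval_C, sub_zero, one_mul, Complex.coe_algebraMap]
      simp only [Complex.normSq_apply, Complex.mul_im, Complex.mul_re, Complex.add_re,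
        Complex.add_im, Complex.sub_re, Complex.sub_im, Complex.conj_re, Complex.conj_im,
        Complex.ofReal_re, Complex.ofReal_im]
      ring
    have h1 : Complex.normSq (z - r) *
          (z.im * (aeval z g.derivative * (starRingEnd ℂ) (aeval z g)).im) ≤ 0 :=
      mul_nonpos_of_nonneg_of_nonpos (Complex.normSq_nonneg _) ih.1
    have h2 : 0 < z.im ^ 2 * Complex.normSq (aeval z g) :=
      mul_pos (by positivity) (Complex.normSq_pos.2 hg0)
    rw [key]
    exact ⟨by linarith, fun _ => by linarith⟩

end LogDerivative

/-! ### Real roots and multiplicities under `1 + b d/dX`. -/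

section HermitePoulain

variable {A : Type*} [CommRing A]

/-- The operator `1 + b d/dX` on univariate polynomials. -/
def addDeriv (b : A) : Module.End A A[X] :=
  LinearMap.id + b • Polynomial.derivative

lemma addDeriv_apply (b : A) (p : A[X]) : addDeriv b p = p + C b * derivative p := by
  simp [addDeriv, smul_eq_C_mul]

lemma addDeriv_zero : addDeriv (0 : A) = 1 := by
  rw [addDeriv, zero_smul, add_zero]
  rfl

lemma addDeriv_monic_natDegree [Nontrivial A] (b : A) {p : A[X]} {d : ℕ}
    (hp : p.Monic ∧ p.natDegree = d) :
    (addDeriv b p).Monic ∧ (addDeriv b p).natDegree = d := by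
  obtain ⟨hm, rfl⟩ := hp
  have hlt : (C b * derivative p).degree < p.degree :=
    by
    rw [← smul_eq_C_mul]
    exact (degree_smul_le b _).trans_lt (degree_derivative_lt hm.ne_zero)
  rw [addDeriv_apply]
  exact ⟨hm.add_of_left hlt, natDegree_add_eq_left_of_degree_lt hlt⟩

/-- At a nonreal root of `p + b p'` the quotient `p'/p = -1/b` would be real, against
`im_derivative_mul_conj_prod`. -/
lemma addDeriv_splits (b : ℝ) {p : ℝ[X]} (hm : p.Monic) (hs : p.Splits) :
    (addDeriv b p).Splits := by
  refine Splits.of_splits_map Complex.ofRealHom (IsAlgClosed.splits _) fun z hz => ?_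
  have hz0 : aeval z (addDeriv b p) = 0 := by
    have := (mem_roots'.1 hz).2
    rwa [IsRoot.def, eval_map] at this
  suffices him : z.im = 0 from ⟨z.re, by apply Complex.ext <;> simp [him]⟩
  by_contra hne
  have hpz : aeval z p ≠ 0 := fun h => hne (realRooted_of_splits hm hs z h)
  have hlog := im_derivative_mul_conj_prod p.roots z hne
  rw [← hs.eq_prod_roots_of_monic hm] at hlog
  rw [addDeriv_apply, map_add, map_mul, aeval_C, Complex.coe_algebraMap] at hz0
  have hroots : p.roots ≠ 0 := by
    intro h0
    have : p = 1 := by rw [hs.eq_prod_roots_of_monic hm, h0]; simp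
    rw [this] at hz0
    simp at hz0
  have hneg := hlog.2 hroots
  have h3 : (b : ℂ) * (aeval z p.derivative * (starRingEnd ℂ) (aeval z p)) =
      -(Complex.normSq (aeval z p) : ℂ) := by
    rw [← Complex.mul_conj]
    linear_combination (starRingEnd ℂ (aeval z p)) * hz0
  have h4 := congrArg Complex.im h3
  have h5 := congrArg Complex.re h3
  simp only [Complex.re_ofReal_mul, Complex.im_ofReal_mul, Complex.neg_re, Complex.neg_im,
    Complex.ofReal_re, Complex.ofReal_im, neg_zero] at h4 h5
  rcases mul_eq_zero.1 h4 with h | h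
  · rw [h, zero_mul] at h5
    exact hpz (Complex.normSq_eq_zero.1 (by linarith))
  · rw [h, mul_zero] at hneg
    exact lt_irrefl _ hneg

/-- Monic real polynomials of degree `d` that split over `ℝ` with all roots of multiplicity
at most `m`. -/
def SplitsMult (d m : ℕ) (p : ℝ[X]) : Prop :=
  (p.Monic ∧ p.natDegree = d) ∧ p.Splits ∧ ∀ x, p.rootMultiplicity x ≤ m

lemma SplitsMult.mono {d m k : ℕ} {p : ℝ[X]} (h : SplitsMult d m p) (hk : m ≤ k) :
    SplitsMult d k p :=
  ⟨h.1, h.2.1, fun x => (h.2.2 x).trans hk⟩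

/-- If the full power of `X - x` dividing `p` also divided `p + b p'`, it would divide `p'`, where
the multiplicity is one less. -/
lemma rootMultiplicity_addDeriv_of_isRoot {b : ℝ} (hb : b ≠ 0) {p : ℝ[X]} (hp : p ≠ 0)
    {x : ℝ} (hx : p.IsRoot x) :
    (addDeriv b p).rootMultiplicity x ≤ p.rootMultiplicity x - 1 := by
  have hpos : 0 < p.rootMultiplicity x := (rootMultiplicity_pos hp).2 hx
  by_contra hlt
  have hd0 : derivative p ≠ 0 := by
    intro h0
    have h1 := derivative_eq_zero.1 h0
    rw [eq_C_of_natDegree_eq_zero h1] at hx hp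
    simp_all
  have h1 : (X - C x) ^ p.rootMultiplicity x ∣ addDeriv b p :=
    (pow_dvd_pow _ (by omega)).trans (pow_rootMultiplicity_dvd _ x)
  rw [addDeriv_apply, dvd_add_right (pow_rootMultiplicity_dvd _ x)] at h1
  have h2 : (X - C x) ^ p.rootMultiplicity x ∣ derivative p := by
    rwa [(isUnit_C.2 hb.isUnit).dvd_mul_left] at h1
  rw [← le_rootMultiplicity_iff hd0, derivative_rootMultiplicity_of_root hx] at h2
  omega

/-- A double root gives `p + b p' = 0` and `p' + b p'' = 0`; eliminating yields `b (p'² - p p'') =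
0`, against the strict Laguerre inequality. -/
lemma rootMultiplicity_addDeriv_of_not_isRoot {b : ℝ} (hb : b ≠ 0) {p : ℝ[X]} (hm : p.Monic)
    (hs : p.Splits) {x : ℝ} (hx : p.eval x ≠ 0) :
    (addDeriv b p).rootMultiplicity x ≤ 1 := by
  by_contra hlt
  have hq0 : addDeriv b p ≠ 0 := (addDeriv_monic_natDegree b ⟨hm, rfl⟩).1.ne_zero
  obtain ⟨h0, h1⟩ := (one_lt_rootMultiplicity_iff_isRoot hq0).1 (not_le.1 hlt)
  simp only [addDeriv_apply, IsRoot.def, derivative_add, derivative_mul, derivative_C,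
    eval_add, eval_mul, eval_C, zero_mul, zero_add] at h0 h1
  have hL := laguerre_prod p.roots x
  rw [← hs.eq_prod_roots_of_monic hm] at hL
  have hroots : p.roots ≠ 0 := by
    intro h
    have : p = 1 := by rw [hs.eq_prod_roots_of_monic hm, h]; simp
    rw [this] at h0
    simp at h0
  have h2 := hL.2 hroots hx
  have h3 : b * (p.derivative.eval x ^ 2 - p.eval x * p.derivative.derivative.eval x) = 0 := by
    linear_combination (p.derivative.eval x) * h0 - (p.eval x) * h1
  rcases mul_eq_zero.1 h3 with h | h
  · exact hb h
  · exact h2.ne' h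

lemma SplitsMult.addDeriv_of_ne_zero {d m : ℕ} {b : ℝ} (hb : b ≠ 0) {p : ℝ[X]}
    (h : SplitsMult d m p) : SplitsMult d (max 1 (m - 1)) (addDeriv b p) := by
  refine ⟨addDeriv_monic_natDegree b h.1, addDeriv_splits b h.1.1 h.2.1, fun x => ?_⟩
  by_cases hx : p.IsRoot x
  · have h1 := rootMultiplicity_addDeriv_of_isRoot hb h.1.1.ne_zero hx
    have h2 := h.2.2 x
    omega
  · exact (rootMultiplicity_addDeriv_of_not_isRoot hb h.1.1 h.2.1 hx).trans (le_max_left _ _)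

lemma SplitsMult.addDeriv {d m : ℕ} (b : ℝ) (hm : 1 ≤ m) {p : ℝ[X]}
    (h : SplitsMult d m p) : SplitsMult d m (addDeriv b p) := by
  by_cases hb : b = 0
  · rw [hb, addDeriv_zero]
    exact h
  · exact (h.addDeriv_of_ne_zero hb).mono (by omega)

lemma SplitsMult.addDeriv_pow {d m : ℕ} (b : ℝ) (hm : 1 ≤ m) (k : ℕ) {p : ℝ[X]}
    (h : SplitsMult d m p) : SplitsMult d m ((NPath.addDeriv b ^ k) p) := by
  induction k with
  | zero => simpa using h
  | succ k ih =>
    rw [pow_succ', Module.End.mul_apply]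
    exact ih.addDeriv b hm

lemma SplitsMult.addDeriv_pow_of_ne_zero {d m : ℕ} {b : ℝ} (hb : b ≠ 0) (k : ℕ)
    {p : ℝ[X]} (h : SplitsMult d m p) :
    SplitsMult d (max 1 (m - k)) ((NPath.addDeriv b ^ k) p) := by
  induction k with
  | zero => simpa using h.mono (le_max_right 1 m)
  | succ k ih =>
    rw [pow_succ', Module.End.mul_apply]
    exact (ih.addDeriv_of_ne_zero hb).mono (by omega)

lemma SplitsMult.list_prod {ι : Type*} {d m : ℕ} (b : ι → ℝ) (hm : 1 ≤ m) (k : ℕ) (l : List ι)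
    {p : ℝ[X]} (h : SplitsMult d m p) :
    SplitsMult d m ((l.map fun i => NPath.addDeriv (b i) ^ k).prod p) := by
  induction l with
  | nil => simpa using h
  | cons i l ih =>
    rw [List.map_cons, List.prod_cons, Module.End.mul_apply]
    exact ih.addDeriv_pow _ hm k

/-- The `d` applications of the one nontrivial factor bring the bound from `d` down to 1; the
remaining factors do not raise it. -/
lemma SplitsMult.list_prod_of_mem {ι : Type*} {d : ℕ} (hd : 1 ≤ d) (b : ι → ℝ) (l : List ι)
    {i : ι} (hi : i ∈ l) (hb : b i ≠ 0) {p : ℝ[X]} (h : SplitsMult d d p) :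
    SplitsMult d 1 ((l.map fun i => NPath.addDeriv (b i) ^ d).prod p) := by
  induction l with
  | nil => simp at hi
  | cons j l ih =>
    rw [List.map_cons, List.prod_cons, Module.End.mul_apply]
    rcases List.mem_cons.1 hi with rfl | hi
    · simpa using (h.list_prod b hd d l).addDeriv_pow_of_ne_zero hb d
    · exact (ih hi).addDeriv_pow _ le_rfl d

lemma splitsMult_X_pow (d : ℕ) : SplitsMult d d (X ^ d) := by
  refine ⟨⟨monic_X_pow d, natDegree_X_pow d⟩, Splits.X_pow d, fun x => ?_⟩
  rw [← count_roots]
  refine (Multiset.count_le_card _ _).trans ((card_roots' _).trans ?_)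
  rw [natDegree_X_pow]

lemma SplitsMult.derivative_ne_zero {d : ℕ} {p : ℝ[X]} (h : SplitsMult d 1 p) (x : ℝ)
    (hx : p.IsRoot x) : p.derivative.eval x ≠ 0 := fun h0 =>
  not_lt.2 (h.2.2 x) ((one_lt_rootMultiplicity_iff_isRoot h.1.1.ne_zero).2 ⟨hx, h0⟩)

end HermitePoulain

/-! ### Propagation of real-rootedness along a path. -/

section Perturbation

lemma eventually_sign_change {p : ℝ[X]} {r : ℝ} (hr : p.IsRoot r)
    (hd : p.derivative.eval r ≠ 0) :
    ∀ᶠ ε in 𝓝[>] (0 : ℝ), p.eval (r - ε) * p.eval (r + ε) < 0 := by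
  obtain ⟨q, rfl⟩ := dvd_iff_isRoot.2 hr
  have hq : q.eval r ≠ 0 := by simpa [derivative_mul] using hd
  have hcont : Continuous fun ε : ℝ => q.eval (r - ε) * q.eval (r + ε) := by
    fun_prop
  have h0 : ∀ᶠ ε in 𝓝 (0 : ℝ), 0 < q.eval (r - ε) * q.eval (r + ε) := by
    refine hcont.continuousAt.eventually (lt_mem_nhds ?_)
    simpa using mul_self_pos.2 hq
  filter_upwards [nhdsWithin_le_nhds h0, self_mem_nhdsWithin] with ε h1 h2
  have h3 : (0 : ℝ) < ε := h2
  have h4 : 0 < ε ^ 2 * (q.eval (r - ε) * q.eval (r + ε)) := by positivity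
  simp only [eval_mul, eval_sub, eval_X, eval_C]
  linear_combination h4

/-- Splitting with simple roots is an open condition in continuous families of monic real
polynomials of fixed degree. -/
lemma eventually_splits {S : Type*} [TopologicalSpace S] {d : ℕ} (p : S → ℝ[X])
    (hp : ∀ s, p s ≠ 0 ∧ (p s).natDegree = d) (hcont : ∀ x, Continuous fun s => (p s).eval x)
    (s₀ : S) (hs : (p s₀).Splits)
    (hsimple : ∀ x, (p s₀).IsRoot x → (p s₀).derivative.eval x ≠ 0) :
    ∀ᶠ s in 𝓝 s₀, (p s).Splits := by
  classical
  set R := (p s₀).roots.toFinset with hR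
  have hroot : ∀ r ∈ R, (p s₀).IsRoot r := fun r hr => (mem_roots'.1 (Multiset.mem_toFinset.1 hr)).2
  have hcard : R.card = d := by
    rw [hR, Multiset.toFinset_card_of_nodup, ← hs.natDegree_eq_card_roots, (hp s₀).2]
    rw [Multiset.nodup_iff_count_le_one]
    intro x
    rw [count_roots]
    by_contra hlt
    obtain ⟨h1, h2⟩ := (one_lt_rootMultiplicity_iff_isRoot (hp s₀).1).1 (not_le.1 hlt)
    exact hsimple x h1 h2
  -- One `ε` makes the intervals about the `d` roots disjoint and gives `p s₀` opposite signs at the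
  -- ends of each. The signs persist near `s₀`, so each interval keeps a root, and `d` distinct
  -- roots exhaust the degree.
  have hsep : ∀ᶠ ε in 𝓝[>] (0 : ℝ), ∀ r ∈ R, ∀ r' ∈ R, r ≠ r' → 2 * ε < |r - r'| := by
    rw [eventually_all_finset]
    intro r _
    rw [eventually_all_finset]
    intro r' _
    by_cases hrr : r = r'
    · simp [hrr]
    · have : ∀ᶠ ε in 𝓝 (0 : ℝ), 2 * ε < |r - r'| := by
        have hc : Continuous fun ε : ℝ => 2 * ε := by fun_prop
        refine hc.continuousAt.eventually (gt_mem_nhds ?_)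
        simpa using abs_pos.2 (sub_ne_zero.2 hrr)
      filter_upwards [nhdsWithin_le_nhds this] with ε h _ using h
  have hsign : ∀ᶠ ε in 𝓝[>] (0 : ℝ), ∀ r ∈ R, (p s₀).eval (r - ε) * (p s₀).eval (r + ε) < 0 := by
    rw [eventually_all_finset]
    exact fun r hr => eventually_sign_change (hroot r hr) (hsimple r (hroot r hr))
  obtain ⟨ε, ⟨hε1, hε2⟩, hε⟩ := ((hsep.and hsign).and self_mem_nhdsWithin).exists
  have hε0 : (0 : ℝ) < ε := hε
  have hev : ∀ᶠ s in 𝓝 s₀, ∀ r ∈ R, (p s).eval (r - ε) * (p s).eval (r + ε) < 0 := by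
    rw [eventually_all_finset]
    intro r hr
    exact ((hcont (r - ε)).mul (hcont (r + ε))).continuousAt.eventually (gt_mem_nhds (hε2 r hr))
  filter_upwards [hev] with s hs'
  have hex : ∀ r : ℝ, ∃ y : ℝ, r ∈ R → y ∈ Set.Icc (r - ε) (r + ε) ∧ (p s).IsRoot y := by
    intro r
    by_cases hr : r ∈ R
    · have hle : r - ε ≤ r + ε := by linarith
      have hc : ContinuousOn (fun y => (p s).eval y) (Set.Icc (r - ε) (r + ε)) :=
        (p s).continuous.continuousOn
      rcases mul_neg_iff.1 (hs' r hr) with ⟨h1, h2⟩ | ⟨h1, h2⟩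
      · obtain ⟨y, hy, h⟩ := intermediate_value_Icc' hle hc ⟨h2.le, h1.le⟩
        exact ⟨y, fun _ => ⟨hy, h⟩⟩
      · obtain ⟨y, hy, h⟩ := intermediate_value_Icc hle hc ⟨h1.le, h2.le⟩
        exact ⟨y, fun _ => ⟨hy, h⟩⟩
    · exact ⟨0, fun h => absurd h hr⟩
  choose f hf using hex
  have hinj : Set.InjOn f R := by
    intro r hr r' hr' heq
    by_contra hne
    have h1 := hε1 r hr r' hr' hne
    have h2 := (hf r hr).1
    have h3 := (hf r' hr').1
    rw [heq] at h2
    have : |r - r'| ≤ 2 * ε := by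
      rw [abs_le]
      constructor <;> linarith [h2.1, h2.2, h3.1, h3.2]
    linarith
  have hsub : R.image f ⊆ (p s).roots.toFinset := by
    intro y hy
    obtain ⟨r, hr, rfl⟩ := Finset.mem_image.1 hy
    exact Multiset.mem_toFinset.2 (mem_roots'.2 ⟨(hp s).1, (hf r hr).2⟩)
  have h1 := Finset.card_le_card hsub
  rw [Finset.card_image_of_injOn hinj, hcard] at h1
  rw [splits_iff_card_roots]
  refine le_antisymm (card_roots' _) ?_
  rw [(hp s).2]
  exact h1.trans (Multiset.toFinset_card_le _)

/-- A path of monic real polynomials that starts at a split polynomial and has only simple real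
roots before the end point ends at a split polynomial. -/
lemma splits_of_path {d : ℕ} (p : ℝ → ℝ[X]) (hp : ∀ s, (p s).Monic ∧ (p s).natDegree = d)
    (hcont : ∀ i, Continuous fun s => (p s).coeff i) (h0 : (p 0).Splits)
    (hsimple : ∀ s ∈ Set.Ico (0 : ℝ) 1, ∀ x, (p s).IsRoot x → (p s).derivative.eval x ≠ 0) :
    (p 1).Splits := by
  have hset : {s | (p s).Splits} = {s | ∀ z : ℂ, |z.im| ^ d ≤ ‖aeval z (p s)‖} := by
    ext s
    refine ⟨fun h z => ?_, fun h => splits_of_im_pow_le ?_⟩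
    · simpa [(hp s).2] using im_pow_le_of_splits (hp s).1 h z
    · simpa [(hp s).2] using h
  have hcl : IsClosed {s | (p s).Splits} := by
    rw [hset, Set.ofPred_forall]
    refine isClosed_iInter fun z => isClosed_le continuous_const (Continuous.norm ?_)
    have : (fun s => aeval z (p s)) =
        fun s => ∑ i ∈ Finset.range (d + 1), ((p s).coeff i : ℂ) * z ^ i := by
      ext s
      rw [aeval_eq_sum_range, (hp s).2]
      simp
    rw [this]
    exact continuous_finsetSum _ fun i _ =>
      (Complex.continuous_ofReal.comp (hcont i)).mul continuous_const
  have heval : ∀ x, Continuous fun s => (p s).eval x := by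
    intro x
    have : (fun s => (p s).eval x) =
        fun s => ∑ i ∈ Finset.range (d + 1), (p s).coeff i * x ^ i := by
      ext s
      rw [eval_eq_sum_range, (hp s).2]
    rw [this]
    exact continuous_finsetSum _ fun i _ => (hcont i).mul continuous_const
  have hsub : Set.Icc (0 : ℝ) 1 ⊆ {s | (p s).Splits} := by
    -- Continuous induction on `[0, 1]`: a closed set that can be extended to the right of each of
    -- its points below 1.
    refine (hcl.inter isClosed_Icc).Icc_subset_of_forall_exists_gt h0 ?_
    rintro x ⟨hx, hx1⟩ y hy
    have hev := eventually_splits p (fun s => ⟨(hp s).1.ne_zero, (hp s).2⟩) heval x hx (hsimple x hx1)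
    have hev' : ∀ᶠ s in 𝓝[>] x, (p s).Splits := nhdsWithin_le_nhds hev
    obtain ⟨s, h1, h2⟩ := (hev'.and (Ioc_mem_nhdsGT hy)).exists
    exact ⟨s, h1, h2⟩
  exact hsub ⟨zero_le_one, le_rfl⟩

end Perturbation

/-! ### Substituting `x = a` turns the operators into `1 + b d/dX`. -/

section Specialization

variable {R A B : Type*} [CommRing R] [CommRing A] [CommRing B] {n : ℕ}

/-- The specialization `P ↦ P(X, a) ∈ A[X]` with coefficients mapped along `φ`. -/
def specialize (φ : R →+* A) (a : Fin n → A) : MvPolynomial (Fin (n + 1)) R →+* A[X] :=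
  MvPolynomial.eval₂Hom (C.comp φ) (Fin.cons X fun i => C (a i))

@[simp] lemma specialize_C (φ : R →+* A) (a : Fin n → A) (r : R) :
    specialize φ a (MvPolynomial.C r) = C (φ r) := by
  simp [specialize]

@[simp] lemma specialize_X_zero (φ : R →+* A) (a : Fin n → A) :
    specialize φ a (MvPolynomial.X 0) = X := by
  simp [specialize]

@[simp] lemma specialize_X_succ (φ : R →+* A) (a : Fin n → A) (i : Fin n) :
    specialize φ a (MvPolynomial.X i.succ) = C (a i) := by
  simp [specialize]

lemma map_specialize (ψ : A →+* B) (φ : R →+* A) (a : Fin n → A)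
    (P : MvPolynomial (Fin (n + 1)) R) :
    (specialize φ a P).map ψ = specialize (ψ.comp φ) (fun i => ψ (a i)) P := by
  suffices h : (mapRingHom ψ).comp (specialize φ a) =
      specialize (ψ.comp φ) (fun i => ψ (a i)) from congrArg (fun f => f P) h
  ext i j
  · simp
  · refine Fin.cases ?_ (fun k => ?_) i <;> simp

lemma specialize_map (ψ : A →+* B) (φ : R →+* A) (a : Fin n → B)
    (P : MvPolynomial (Fin (n + 1)) R) :
    specialize ψ a (MvPolynomial.map φ P) = specialize (ψ.comp φ) a P := by
  simp [specialize, RingHom.comp_assoc]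

lemma finSuccEquiv_eq_specialize (P : MvPolynomial (Fin (n + 1)) R) :
    MvPolynomial.finSuccEquiv R n P = specialize MvPolynomial.C MvPolynomial.X P := by
  rw [MvPolynomial.finSuccEquiv_apply]
  rfl

lemma map_finSuccEquiv (φ : R →+* A) (a : Fin n → A) (P : MvPolynomial (Fin (n + 1)) R) :
    (MvPolynomial.finSuccEquiv R n P).map (MvPolynomial.eval₂Hom φ a) = specialize φ a P := by
  rw [finSuccEquiv_eq_specialize, map_specialize]
  congr 2
  · ext; simp
  · ext; simp

lemma specialize_pderiv_zero (φ : R →+* A) (a : Fin n → A) (P : MvPolynomial (Fin (n + 1)) R) :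
    specialize φ a (MvPolynomial.pderiv 0 P) = derivative (specialize φ a P) := by
  induction P using MvPolynomial.induction_on with
  | C r => simp
  | add p q hp hq => simp only [map_add, hp, hq]
  | mul_X p i hp =>
    rw [Derivation.leibniz]
    simp only [smul_eq_mul, map_add, map_mul, hp, derivative_mul]
    refine Fin.cases ?_ (fun k => ?_) i
    · simp [add_comm, mul_comm]
    · rw [MvPolynomial.pderiv_X_of_ne (Fin.succ_ne_zero k)]
      simp [mul_comm]

lemma specialize_opT (φ : R →+* A) (a : Fin n → A) (i : Fin n) (s : R)
    (P : MvPolynomial (Fin (n + 1)) R) :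
    specialize φ a (opT (MvPolynomial.X i) s P) =
      addDeriv (φ s * a i) (specialize φ a P) := by
  simp [opT, addDeriv_apply, MvPolynomial.smul_eq_C_mul, specialize_pderiv_zero, mul_assoc]

lemma specialize_opG (φ : R →+* A) (a : Fin n → A) (s : R) (P : MvPolynomial (Fin (n + 1)) R) :
    specialize φ a (opG s P) = specialize φ (fun i => φ s * a i) P := by
  induction P using MvPolynomial.induction_on with
  | C r => simp [opG]
  | add p q hp hq => simp only [map_add, hp, hq]
  | mul_X p i hp =>
    have h : opG s (p * MvPolynomial.X i) = opG s p * opG s (MvPolynomial.X i) := by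
      simp [opG]
    rw [h, map_mul, map_mul, hp]
    congr 1
    refine Fin.cases ?_ (fun k => ?_) i <;> simp [opG]

lemma specialize_opH (φ : R →+* A) (a : Fin n → A) (d : ℕ) (s : R)
    (P : MvPolynomial (Fin (n + 1)) R) :
    specialize φ a (opH d s P) =
      ((List.finRange n).map fun i => addDeriv (φ s * a i) ^ d).prod (specialize φ a P) := by
  have hpow : ∀ (i : Fin n) (k : ℕ) (Q : MvPolynomial (Fin (n + 1)) R),
      specialize φ a ((opT (MvPolynomial.X i) s ^ k) Q) =
        (addDeriv (φ s * a i) ^ k) (specialize φ a Q) := by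
    intro i k Q
    induction k with
    | zero => simp
    | succ k ih =>
      rw [pow_succ', pow_succ', Module.End.mul_apply, Module.End.mul_apply, specialize_opT, ih]
  rw [opH, List.ofFn_eq_map]
  induction List.finRange n with
  | nil => simp
  | cons i l ih =>
    rw [List.map_cons, List.map_cons, List.prod_cons, List.prod_cons, Module.End.mul_apply,
      Module.End.mul_apply, hpow, ih]

lemma specialize_opN (φ : R →+* A) (a : Fin n → A) (d : ℕ) (s : R)
    (P : MvPolynomial (Fin (n + 1)) R) :
    specialize φ a (opN d s P) =
      ((List.finRange n).map fun i => addDeriv ((1 - φ s) * a i) ^ d).prod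
        (specialize φ (fun i => φ s * a i) P) := by
  rw [opN, Module.End.mul_apply, specialize_opH, specialize_opG]
  simp

lemma list_prod_addDeriv_monic_natDegree [Nontrivial A] {ι : Type*} (b : ι → A) (k : ℕ)
    (l : List ι) {p : A[X]} {d : ℕ} (hp : p.Monic ∧ p.natDegree = d) :
    ((l.map fun i => addDeriv (b i) ^ k).prod p).Monic ∧
      ((l.map fun i => addDeriv (b i) ^ k).prod p).natDegree = d := by
  have hpow : ∀ (c : A) (j : ℕ) {q : A[X]}, (q.Monic ∧ q.natDegree = d) →
      ((addDeriv c ^ j) q).Monic ∧ ((addDeriv c ^ j) q).natDegree = d := by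
    intro c j q hq
    induction j with
    | zero => simpa using hq
    | succ j ih =>
      rw [pow_succ', Module.End.mul_apply]
      exact addDeriv_monic_natDegree c ih
  induction l with
  | nil => simpa using hp
  | cons i l ih =>
    rw [List.map_cons, List.prod_cons, Module.End.mul_apply]
    exact hpow _ _ ih

end Specialization

/-! ### The path attached to a form and its discriminant. -/

section Forms

variable {A : Type*} [CommRing A] {n d : ℕ} {F : MvPolynomial (Fin (n + 1)) ℝ}

/-- By homogeneity only the `t ^ d` term survives at `x = 0`, and its coefficient is `F(e) = 1`. -/
lemma eval_zero_finSuccEquiv (hF : F ∈ formSet n d) :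
    (MvPolynomial.finSuccEquiv ℝ n F).map (MvPolynomial.eval 0) = X ^ d := by
  set f := (MvPolynomial.finSuccEquiv ℝ n F).map (MvPolynomial.eval (0 : Fin n → ℝ)) with hf
  have hcoeff : ∀ i, i ≠ d → f.coeff i = 0 := by
    intro i hi
    rw [hf, coeff_map, MvPolynomial.eval_zero, MvPolynomial.constantCoeff_eq,
      MvPolynomial.finSuccEquiv_coeff_coeff]
    refine hF.1.coeff_eq_zero ?_
    simpa [Finsupp.degree_eq_sum, Fin.sum_univ_succ] using hi
  have hmon : f = monomial d (f.coeff d) := by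
    ext i
    rw [coeff_monomial]
    split_ifs with h
    · rw [h]
    · exact hcoeff i (Ne.symm h)
  have h1 : f.eval 1 = 1 := by
    have h2 := MvPolynomial.eval_eq_eval_mv_eval' (0 : Fin n → ℝ) 1 F
    rw [← hf] at h2
    rw [← h2]
    exact hF.2
  rw [hmon, eval_monomial, one_pow, mul_one] at h1
  rw [hmon, h1, monomial_one_right_eq_X_pow]

lemma finSuccEquiv_monic_natDegree (hF : F ∈ formSet n d) :
    (MvPolynomial.finSuccEquiv ℝ n F).Monic ∧ (MvPolynomial.finSuccEquiv ℝ n F).natDegree = d := by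
  have hle : (MvPolynomial.finSuccEquiv ℝ n F).natDegree ≤ d := by
    rw [MvPolynomial.natDegree_finSuccEquiv]
    exact (MvPolynomial.degreeOf_le_totalDegree _ _).trans hF.1.totalDegree_le
  -- The coefficient of `t ^ d` is a form of degree 0, hence constant, so its value at `x = 0`
  -- determines it.
  have hhom := hF.1.finSuccEquiv_coeff_isHomogeneous d 0 (add_zero d)
  have hcoeff : (MvPolynomial.finSuccEquiv ℝ n F).coeff d = 1 := by
    rw [← MvPolynomial.totalDegree_zero_iff_isHomogeneous,
      MvPolynomial.totalDegree_eq_zero_iff_eq_C] at hhom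
    have h1 := congrArg (fun p => p.coeff d) (eval_zero_finSuccEquiv hF)
    simp only [coeff_map, coeff_X_pow_self] at h1
    rw [hhom, MvPolynomial.eval_C] at h1
    rw [hhom, h1, map_one]
  have hm := monic_of_natDegree_le_of_coeff_eq_one d hle hcoeff
  refine ⟨hm, le_antisymm hle ?_⟩
  exact le_natDegree_of_ne_zero (by rw [hcoeff]; exact one_ne_zero)

lemma specialize_monic_natDegree [Nontrivial A] (hF : F ∈ formSet n d) (φ : ℝ →+* A)
    (a : Fin n → A) : (specialize φ a F).Monic ∧ (specialize φ a F).natDegree = d := by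
  obtain ⟨hm, hd⟩ := finSuccEquiv_monic_natDegree hF
  rw [← map_finSuccEquiv]
  exact ⟨hm.map _, by rw [hm.natDegree_map, hd]⟩

lemma specialize_zero (hF : F ∈ formSet n d) : specialize (RingHom.id ℝ) 0 F = X ^ d := by
  rw [← map_finSuccEquiv, ← eval_zero_finSuccEquiv hF]
  rfl

/-- `N_s(F)(X, a)` for a real number `s`. -/
def pathAt (d : ℕ) (F : MvPolynomial (Fin (n + 1)) ℝ) (a : Fin n → ℝ) (s : ℝ) : ℝ[X] :=
  specialize (evalRingHom s) a (opN d (X : ℝ[X]) (MvPolynomial.map C F))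

lemma pathAt_eq (a : Fin n → ℝ) (s : ℝ) :
    pathAt d F a s = ((List.finRange n).map fun i => addDeriv ((1 - s) * a i) ^ d).prod
      (specialize (RingHom.id ℝ) (fun i => s * a i) F) := by
  rw [pathAt, specialize_opN, specialize_map]
  have : (evalRingHom s).comp C = RingHom.id ℝ := by ext; simp
  rw [this]
  simp

lemma pathAt_monic_natDegree (hF : F ∈ formSet n d) (a : Fin n → ℝ) (s : ℝ) :
    (pathAt d F a s).Monic ∧ (pathAt d F a s).natDegree = d := by
  rw [pathAt_eq]
  exact list_prod_addDeriv_monic_natDegree _ d _ (specialize_monic_natDegree hF _ _)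

lemma continuous_coeff_pathAt (a : Fin n → ℝ) (i : ℕ) :
    Continuous fun s => (pathAt d F a s).coeff i := by
  have h : ∀ s, pathAt d F a s = (specialize (RingHom.id ℝ[X]) (fun i => C (a i))
      (opN d (X : ℝ[X]) (MvPolynomial.map C F))).map (evalRingHom s) := by
    intro s
    rw [map_specialize, pathAt]
    simp
  simp only [h, coeff_map, coe_evalRingHom]
  exact Polynomial.continuous _

lemma splitsMult_pathAt_zero (hd : 1 ≤ d) (hF : F ∈ formSet n d) {a : Fin n → ℝ} (ha : a ≠ 0) :
    SplitsMult d 1 (pathAt d F a 0) := by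
  obtain ⟨i, hi⟩ := Function.ne_iff.1 ha
  have h0 : specialize (RingHom.id ℝ) (fun i => 0 * a i) F = X ^ d := by
    rw [← specialize_zero hF]
    congr 1
    simp only [zero_mul]
    rfl
  rw [pathAt_eq, h0]
  exact (splitsMult_X_pow d).list_prod_of_mem hd _ _ (List.mem_finRange i) (by simpa using hi)

lemma pathAt_one (a : Fin n → ℝ) : pathAt d F a 1 = specialize (RingHom.id ℝ) a F := by
  rw [pathAt_eq]
  simp [addDeriv_zero]

lemma finSuccEquiv_opN_monic_natDegree (hF : F ∈ formSet n d) :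
    (MvPolynomial.finSuccEquiv ℝ[X] n (opN d X (MvPolynomial.map C F))).Monic ∧
      (MvPolynomial.finSuccEquiv ℝ[X] n (opN d X (MvPolynomial.map C F))).natDegree = d := by
  rw [finSuccEquiv_eq_specialize, specialize_opN, specialize_map]
  exact list_prod_addDeriv_monic_natDegree _ d _ (specialize_monic_natDegree hF _ _)

/-- For monic `f` the discriminant is, up to sign, the resultant of `f` and `f'`. Monicity and
characteristic zero keep both degrees under `φ`, so the resultant specializes correctly. -/
lemma isCoprime_map_derivative_of_discr_ne_zero {K : Type*} [Field K] [CharZero K] {f : A[X]}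
    (hf : f.Monic) (hpos : 0 < f.natDegree) (φ : A →+* K) (h : φ f.discr ≠ 0) :
    IsCoprime (f.map φ) (derivative (f.map φ)) := by
  have h1 := congrArg φ (resultant_deriv (natDegree_pos_iff_degree_pos.1 hpos))
  rw [← resultant_map_map, ← derivative_map] at h1
  have h2 : (f.map φ).natDegree = f.natDegree := hf.natDegree_map φ
  have h3 : (derivative (f.map φ)).natDegree = f.natDegree - 1 := by
    rw [natDegree_derivative, h2]
  rw [← h3, ← h2] at h1
  by_contra hc
  have h4 : resultant (f.map φ) (derivative (f.map φ)) = 0 :=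
    resultant_eq_zero_iff.2 ⟨Or.inl (hf.map φ).ne_zero, hc⟩
  rw [h4, hf.leadingCoeff] at h1
  simp [h] at h1

lemma derivative_pathAt_ne_zero (hd : 1 ≤ d) (hF : F ∈ formSet n d) (a : Fin n → ℝ) (s : ℝ)
    (h : evalAt (nPathDiscr d F) s a ≠ 0) (x : ℝ) (hx : (pathAt d F a s).IsRoot x) :
    (pathAt d F a s).derivative.eval x ≠ 0 := by
  obtain ⟨hm, hdeg⟩ := finSuccEquiv_opN_monic_natDegree hF
  have hcop := isCoprime_map_derivative_of_discr_ne_zero hm (by omega)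
    (MvPolynomial.eval₂Hom (evalRingHom s) a) h
  rw [map_finSuccEquiv] at hcop
  intro h0
  obtain ⟨u, v, huv⟩ := hcop
  have h1 := congrArg (eval x) huv
  rw [eval_add, eval_mul, eval_mul] at h1
  change _ * eval x (pathAt d F a s) + _ * eval x (derivative (pathAt d F a s)) = _ at h1
  rw [h0, hx.eq_zero] at h1
  simp at h1

lemma restrictLine_basePoint (F : MvPolynomial (Fin (n + 1)) ℝ) (a : Fin (n + 1) → ℝ) :
    restrictLine F (basePoint n) a =
      (specialize (RingHom.id ℝ) (fun i => -a i.succ) F).comp (X - C (a 0)) := by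
  suffices h : (MvPolynomial.aeval
        (fun i => X * C (basePoint n i) - C (a i)) : _ →ₐ[ℝ] ℝ[X]).toRingHom =
      (compRingHom (X - C (a 0))).comp (specialize (RingHom.id ℝ) (fun i => -a i.succ)) from
    congrArg (fun f => f F) h
  ext i j
  · simp
  · refine congrArg (fun p => coeff p j) ?_
    refine Fin.cases ?_ (fun k => ?_) i <;> simp [basePoint]

end Forms

end NPath

end

theorem mainTheorem5 (n d : ℕ) (hd : 1 ≤ d) (F : MvPolynomial (Fin (n + 1)) ℝ)
    (hF : F ∈ NPath.formSet n d)
    (hΔ : ∀ s : ℝ, s ∈ Set.Ioo (0 : ℝ) 1 → ∀ a : Fin n → ℝ, a ≠ 0 →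
      NPath.evalAt (NPath.nPathDiscr d F) s a ≠ 0) :
    NPath.IsHyperbolic F (NPath.basePoint n) := by
  refine ⟨⟨d, hF.1⟩, by rw [hF.2]; exact one_ne_zero, fun a => ?_⟩
  have hsplits : ∀ b : Fin n → ℝ, (NPath.specialize (RingHom.id ℝ) b F).Splits := by
    intro b
    by_cases hb : b = 0
    · rw [hb, NPath.specialize_zero hF]
      exact Polynomial.Splits.X_pow d
    · have h0 := NPath.splitsMult_pathAt_zero hd hF hb
      rw [← NPath.pathAt_one (d := d)]
      refine NPath.splits_of_path _ (NPath.pathAt_monic_natDegree hF b)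
        (NPath.continuous_coeff_pathAt b) h0.2.1 fun s hs x hx => ?_
      -- The discriminant hypothesis is silent at `s = 0`, where Hermite–Poulain supplies
      -- simplicity.
      rcases hs.1.eq_or_lt with rfl | hs0
      · exact h0.derivative_ne_zero x hx
      · exact NPath.derivative_pathAt_ne_zero hd hF b s (hΔ s ⟨hs0, hs.2⟩ b hb) x hx
  rw [NPath.restrictLine_basePoint]
  refine NPath.realRooted_of_splits ?_ ((hsplits _).comp_X_sub_C _)
  exact (NPath.specialize_monic_natDegree hF _ _).1.comp_X_sub_C _
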